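/- Let $K$ be an algebraically closed field of characteristic zero. A curve in $\mathbb{P}^n = \mathbb{P}^n_K$ is a closed subscheme that is locally Cohen-Macaulay and of pure dimension $1$; it is called non-degenerate if it is not contained (scheme-theoretically) in a hyperplane of $\mathbb{P}^n$. Its degree $d$ and its arithmetic genus $g$ are determined by its Hilbert polynomial, which is $d\,t + 1 - g$. Theorem 3.2. Let $n \geq 3$ and $d \geq 2$ be integers and put $$ g_{\max} := \begin{cases} \binom{d-2}{2} - (n-3) & \text{if } d \geq 3, \\ 2 - n & \text{if } d = 2. \end{cases} $$ Then for every integer $g \leq g_{\max}$ there is a non-degenerate curve $C \subset \mathbb{P}^n$ of degree $d$ and arithmetic genus $g$. -/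

import Mathlib

open AlgebraicGeometry CategoryTheory

universe u

attribute [local instance] MvPolynomial.gradedAlgebra

noncomputable section

namespace LocallyCMCurve

/-- A commutative local ring is Cohen-Macaulay if it is Noetherian and its maximal ideal contains a
regular sequence whose length is the Krull dimension of the ring (that is, depth = dimension). -/
structure IsCohenMacaulayLocalRing (A : Type u) [CommRing A] [IsLocalRing A] : Prop where
  isNoetherianRing : IsNoetherianRing A
  exists_isRegular : ∃ rs : List A, (∀ r ∈ rs, r ∈ IsLocalRing.maximalIdeal A) ∧
    RingTheory.Sequence.IsRegular A rs ∧ (rs.length : WithBot ℕ∞) = ringKrullDim A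

/-- A scheme is locally Cohen-Macaulay if all its local rings are Cohen-Macaulay. -/
def IsLocallyCohenMacaulay (X : Scheme.{u}) : Prop :=
  ∀ x : X, IsCohenMacaulayLocalRing (X.presheaf.stalk x)

/-- A scheme has pure dimension `r` if all its irreducible components have dimension `r`. -/
def HasPureDimension (X : Scheme.{u}) (r : ℕ) : Prop :=
  ∀ Z ∈ irreducibleComponents X, topologicalKrullDim Z = r

variable (K : Type u) [Field K] (n : ℕ)

/-- Projective `n`-space `ℙⁿ = Proj K[x₀, …, xₙ]`. -/
abbrev ProjectiveNSpace : Scheme.{u} :=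
  Proj (MvPolynomial.homogeneousSubmodule (Fin (n + 1)) K)

/-- The standard affine open subset `D₊(xᵢ)` of `ℙⁿ`. -/
abbrev chart (i : Fin (n + 1)) : (ProjectiveNSpace K n).Opens :=
  Proj.basicOpen (MvPolynomial.homogeneousSubmodule (Fin (n + 1)) K) (MvPolynomial.X i)

variable {K n}

/-- The fraction `F / xᵢᵐ`, for a form `F` of degree `m`, in the degree zero part of
`K[x₀, …, xₙ][1/xᵢ]`. -/
def formFraction {m : ℕ} (F : MvPolynomial.homogeneousSubmodule (Fin (n + 1)) K m)
    (i : Fin (n + 1)) :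
    HomogeneousLocalization.Away (MvPolynomial.homogeneousSubmodule (Fin (n + 1)) K)
      (MvPolynomial.X i) :=
  HomogeneousLocalization.Away.mk (MvPolynomial.homogeneousSubmodule (Fin (n + 1)) K)
    (MvPolynomial.isHomogeneous_X K i) m F.1
    ((congrArg (fun k => F.1 ∈ MvPolynomial.homogeneousSubmodule (Fin (n + 1)) K k)
      (mul_one m)).mpr F.2)

theorem val_formFraction {m : ℕ} (F : MvPolynomial.homogeneousSubmodule (Fin (n + 1)) K m)
    (i : Fin (n + 1)) :
    (formFraction F i).val = Localization.mk F.1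
      (⟨MvPolynomial.X i ^ m, ⟨m, rfl⟩⟩ : Submonoid.powers (MvPolynomial.X i)) :=
  HomogeneousLocalization.Away.val_mk _ _ _ _ _

theorem formFraction_zero (m : ℕ) (i : Fin (n + 1)) :
    formFraction (0 : MvPolynomial.homogeneousSubmodule (Fin (n + 1)) K m) i = 0 := by
  apply HomogeneousLocalization.val_injective
  rw [val_formFraction, HomogeneousLocalization.val_zero]
  exact Localization.mk_zero _

theorem formFraction_add {m : ℕ} (F G : MvPolynomial.homogeneousSubmodule (Fin (n + 1)) K m)
    (i : Fin (n + 1)) : formFraction (F + G) i = formFraction F i + formFraction G i := by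
  apply HomogeneousLocalization.val_injective
  rw [HomogeneousLocalization.val_add, val_formFraction, val_formFraction, val_formFraction,
    Localization.add_mk_self]
  rfl

theorem formFraction_smul {m : ℕ} (c : K)
    (F : MvPolynomial.homogeneousSubmodule (Fin (n + 1)) K m) (i : Fin (n + 1)) :
    formFraction (c • F) i =
      formFraction (m := 0) ⟨MvPolynomial.C c, MvPolynomial.isHomogeneous_C _ c⟩ i *
        formFraction F i := by
  apply HomogeneousLocalization.val_injective
  rw [HomogeneousLocalization.val_mul, val_formFraction, val_formFraction, val_formFraction,
    Localization.mk_mul]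
  congr 1
  · exact MvPolynomial.smul_eq_C_mul _ _
  · ext1
    simp

/-- The regular function `F / xᵢᵐ` on `D₊(xᵢ)`, for a form `F` of degree `m`. -/
def dehomogenize {m : ℕ} (F : MvPolynomial.homogeneousSubmodule (Fin (n + 1)) K m)
    (i : Fin (n + 1)) : Γ(ProjectiveNSpace K n, chart K n i) :=
  Proj.awayToSection (MvPolynomial.homogeneousSubmodule (Fin (n + 1)) K) (MvPolynomial.X i)
    (formFraction F i)

variable {C : Scheme.{u}} (ι : C ⟶ ProjectiveNSpace K n)

/-- The degree `m` part of the homogeneous ideal of a closed subscheme `ι : C ⟶ ℙⁿ`: the forms `F`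
of degree `m` that vanish on `C`, i.e. such that each function `F / xᵢᵐ` on `D₊(xᵢ)` restricts to
zero on `C ∩ D₊(xᵢ)`. -/
def vanishingForms (m : ℕ) :
    Submodule K (MvPolynomial.homogeneousSubmodule (Fin (n + 1)) K m) where
  carrier := {F | ∀ i, ι.app (chart K n i) (dehomogenize F i) = 0}
  zero_mem' i := by simp only [dehomogenize, formFraction_zero, map_zero]
  add_mem' {F G} hF hG i := by
    have h1 := hF i
    have h2 := hG i
    simp only [dehomogenize] at h1 h2
    simp only [dehomogenize, formFraction_add, map_add, h1, h2, add_zero]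
  smul_mem' c F hF i := by
    have h := hF i
    simp only [dehomogenize] at h
    simp only [dehomogenize, formFraction_smul, map_mul, h, mul_zero]

/-- The Hilbert function of a closed subscheme `C` of `ℙⁿ`: the dimension of the degree `m` part of
its homogeneous coordinate ring `K[x₀, …, xₙ] / I_C`. -/
def hilbertFunction (m : ℕ) : ℕ :=
  Module.finrank K (MvPolynomial.homogeneousSubmodule (Fin (n + 1)) K m ⧸ vanishingForms ι m)

/-- `P` is the Hilbert polynomial of the closed subscheme `C` of `ℙⁿ`. -/
def IsHilbertPolynomial (P : Polynomial ℚ) : Prop :=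
  ∀ᶠ m : ℕ in Filter.atTop, (hilbertFunction ι m : ℚ) = P.eval (m : ℚ)

/-- The one-dimensional closed subscheme `C` of `ℙⁿ` has degree `d`: its Hilbert polynomial has
degree one and leading coefficient `d`. -/
def HasDegree (d : ℕ) : Prop :=
  ∃ P : Polynomial ℚ, IsHilbertPolynomial ι P ∧ P.natDegree = 1 ∧ P.leadingCoeff = d

/-- The one-dimensional closed subscheme `C` of `ℙⁿ` has arithmetic genus `g`: its Hilbert
polynomial `P` satisfies `g = 1 - P(0)`. -/
def HasArithmeticGenus (g : ℤ) : Prop :=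
  ∃ P : Polynomial ℚ, IsHilbertPolynomial ι P ∧ (g : ℚ) = 1 - P.eval 0

/-- A curve in `ℙⁿ` is a closed subscheme that is locally Cohen-Macaulay of pure dimension one. -/
structure IsCurve : Prop where
  isClosedImmersion : IsClosedImmersion ι
  isLocallyCohenMacaulay : IsLocallyCohenMacaulay C
  hasPureDimension : HasPureDimension C 1

/-- A closed subscheme of `ℙⁿ` is non-degenerate if it is not contained in a hyperplane, i.e. if no
nonzero linear form vanishes on it. -/
def IsNonDegenerate : Prop :=
  ∀ l : MvPolynomial.homogeneousSubmodule (Fin (n + 1)) K 1, l ≠ 0 → l ∉ vanishingForms ι 1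

end LocallyCMCurve

end

/-! Write `n = r + 2`. The curve is a multiple structure on a line: the scheme-theoretic image of
the spectrum of L[y]/(y^d) under (1 : t : y : t^(-N) y^(d-1) : ⋯ : t^(r-1-N) y^(d-1)), where L is an
extension field of K and t ∈ L has linearly independent integer powers. All coordinates are
monomials in t and y, so global questions become counts of exponents.

For m ≥ N + d the values of the forms of degree m span exactly the t^e y^w with 0 ≤ w < d and 0 ≤ e
≤ m - w, the lower bound dropping to -N when w = d - 1 (`range_aeval_lineJet`). Hence the Hilbert
polynomial is d m + d - C(d,2) + N and the genus is C(d-1,2) - N. The construction works for every N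
≥ r + d - 3, with N ≥ r needed for non-degeneracy if d = 2; these bounds on N amount to g ≤ g_max.

The local conditions follow from the embedding of the affine coordinate rings in L[y]/(y^d), whose
elements are units or nilpotent: every non-nilpotent function is regular, and modulo nilpotents the
two nonempty charts are K[t] and K[t⁻¹] (`isCurve_imageι`). -/

noncomputable section

namespace LocallyCMCurve

/-! ### Cohen-Macaulayness of nilpotent thickenings of a principal ideal domain -/

section Algebra

variable {A R : Type*} [CommRing A] [CommRing R]

theorem ringKrullDim_eq_of_surjective_of_ker_le_nilradical (σ : A →+* R)
    (hσ : Function.Surjective σ) (hker : RingHom.ker σ ≤ nilradical A) :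
    ringKrullDim A = ringKrullDim R := by
  rw [← ringKrullDim_eq_of_ringEquiv (RingHom.quotientKerEquivOfSurjective hσ), ringKrullDim_quotient]
  have : PrimeSpectrum.zeroLocus (RingHom.ker σ : Set A) = Set.univ :=
    Set.eq_univ_of_forall fun p x hx => by
      obtain ⟨k, hk⟩ := mem_nilradical.mp (hker hx)
      exact p.2.mem_of_pow_mem k (hk ▸ p.1.zero_mem)
  rw [this]
  exact (Order.krullDim_eq_of_orderIso OrderIso.Set.univ).symm

variable [IsDomain R] [IsPrincipalIdealRing R] (σ : A →+* R) (hσ : Function.Surjective σ)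
  (hker : RingHom.ker σ ≤ nilradical A) (hreg : ∀ a, σ a ≠ 0 → a ∈ nonZeroDivisors A)

include hσ hker in
theorem ringKrullDim_eq_one_of_surjective (hR : ¬ IsField R) : ringKrullDim A = 1 := by
  rw [ringKrullDim_eq_of_surjective_of_ker_le_nilradical σ hσ hker,
    IsPrincipalIdealRing.ringKrullDim_eq_one R hR]

-- Here `A` plays the coordinate ring of a multiple line and `R` that of its reduction; `hreg` rules
-- out embedded points. The localizations have dimension at most one, so a single regular element
-- suffices.
include hσ hker hreg in
theorem isCohenMacaulayLocalRing_of_isLocalization [IsNoetherianRing A] (hR : ¬ IsField R)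
    (p : Ideal A) [p.IsPrime] (S : Type u) [CommRing S] [IsLocalRing S] [Algebra A S]
    [IsLocalization.AtPrime S p] : IsCohenMacaulayLocalRing S := by
  have hnil : RingHom.ker σ ≤ p := fun x hx => by
    obtain ⟨k, hk⟩ := mem_nilradical.mp (hker hx)
    exact ‹p.IsPrime›.mem_of_pow_mem k (hk ▸ p.zero_mem)
  refine ⟨IsLocalization.isNoetherianRing p.primeCompl S inferInstance, ?_⟩
  have hdim := IsLocalization.AtPrime.ringKrullDim_eq_height p S
  by_cases hp : p ≤ RingHom.ker σ
  -- Generic point: `p` lies in the nilradical, so the local ring has dimension zero and the empty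
  -- sequence works.
  · refine ⟨[], by simp, ⟨RingTheory.Sequence.IsWeaklyRegular.nil S S, ?_⟩, ?_⟩
    · simp
    · have : p.height = 0 := by
        rw [Ideal.height_eq_zero_iff]
        refine ⟨⟨‹_›, bot_le⟩, fun q hq _ => hp.trans (hker.trans ?_)⟩
        exact nilradical_le_prime q (H := hq.1)
      simp [hdim, this]
  -- Closed point: an element of `p` outside the kernel is regular and stays so after localization,
  -- and the height is one.
  · obtain ⟨a, hap, ha⟩ := SetLike.not_le_iff_exists.mp hp
    have hmem : algebraMap A S a ∈ IsLocalRing.maximalIdeal S :=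
      (IsLocalization.AtPrime.to_map_mem_maximal_iff S p a).mpr hap
    refine ⟨[algebraMap A S a], by simpa using hmem, ⟨?_, ?_⟩, ?_⟩
    · rw [RingTheory.Sequence.isWeaklyRegular_singleton_iff]
      have := IsLocalization.map_nonZeroDivisors_le p.primeCompl S
        (Submonoid.mem_map_of_mem (algebraMap A S) (hreg a ha))
      exact (mem_nonZeroDivisors_iff_right.mp this |> fun h x y hxy => by
        have : (x - y) * algebraMap A S a = 0 := by
          have hxy' : algebraMap A S a * x = algebraMap A S a * y := hxy
          linear_combination hxy'
        exact sub_eq_zero.mp (h _ this))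
    · intro h
      refine Ideal.IsPrime.ne_top (IsLocalRing.maximalIdeal.isMaximal S).isPrime ?_
      rw [eq_top_iff]
      simp only [Ideal.ofList_singleton, smul_eq_mul, Ideal.mul_top] at h
      rw [h, Ideal.span_singleton_le_iff_mem]
      exact hmem
    · have h1 : p.height ≤ 1 := by
        have := Ideal.height_le_ringKrullDim_of_ne_top (I := p) Ideal.IsPrime.ne_top'
        rw [ringKrullDim_eq_one_of_surjective σ hσ hker hR] at this
        exact_mod_cast this
      have h2 : p.height ≠ 0 := by
        rw [Ne, Ideal.height_eq_zero_iff]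
        intro h
        have hk : (RingHom.ker σ).IsPrime := RingHom.ker_isPrime σ
        exact hp (h.2 ⟨hk, bot_le⟩ hnil)
      have : p.height = 1 := le_antisymm h1 (Order.one_le_iff_ne_zero.mpr h2)
      simp [hdim, this]

end Algebra

/-! ### Pulling back sections and basic opens along morphisms to Proj -/

theorem appLE_eq_of_eq_comp {X Y Z : Scheme.{u}} {f : X ⟶ Z} {g : X ⟶ Y} {h : Y ⟶ Z}
    (hf : f = g ≫ h) (U : Z.Opens) (V : X.Opens) (e : V ≤ f ⁻¹ᵁ U) (e' : V ≤ g ⁻¹ᵁ (h ⁻¹ᵁ U)) :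
    f.appLE U V e = h.app U ≫ g.appLE (h ⁻¹ᵁ U) V e' := by
  subst hf
  exact Scheme.Hom.comp_appLE _ _ _ _ _

section Graded

variable {A : Type u} {σ : Type*} [CommRing A] [SetLike σ A] [AddSubgroupClass σ A]
  (𝒜 : ℕ → σ) [GradedRing 𝒜]

theorem awayToSection_comp_appLE_awayι {f : A} {m : ℕ} (hf : f ∈ 𝒜 m) (hm : 0 < m)
    (e : ⊤ ≤ Proj.awayι 𝒜 f hf hm ⁻¹ᵁ Proj.basicOpen 𝒜 f) :
    Proj.awayToSection 𝒜 f ≫ (Proj.awayι 𝒜 f hf hm).appLE (Proj.basicOpen 𝒜 f) ⊤ e =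
      (Scheme.ΓSpecIso _).inv := by
  have h : (Proj.basicOpenIsoSpec 𝒜 f hf hm).hom.appTop = (Scheme.ΓSpecIso _).hom ≫
      Proj.awayToSection 𝒜 f ≫ (Proj.basicOpen 𝒜 f).topIso.inv := by
    rw [Proj.basicOpenIsoSpec_hom 𝒜 f hf hm]
    exact Proj.basicOpenToSpec_app_top 𝒜 f
  have h2 : (Proj.awayι 𝒜 f hf hm).appLE (Proj.basicOpen 𝒜 f) ⊤ e =
      (Proj.basicOpen 𝒜 f).topIso.inv ≫ (Proj.basicOpenIsoSpec 𝒜 f hf hm).inv.appTop := by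
    have e₁ : ⊤ ≤ (Proj.basicOpen 𝒜 f).ι ⁻¹ᵁ Proj.basicOpen 𝒜 f := by simp
    simp only [Proj.awayι]
    rw [← Scheme.Hom.appLE_comp_appLE _ _ _ ⊤ ⊤ e₁ le_top]
    congr 1
  rw [← Iso.inv_comp_eq] at h
  rw [h2, ← Category.assoc, ← h, Category.assoc, ← Scheme.Hom.comp_appTop, Iso.inv_hom_id]
  simp

theorem awayToSection_comp_appLE {f : A} {m : ℕ} (hf : f ∈ 𝒜 m) (hm : 0 < m) {B : CommRingCat.{u}}
    (φ : CommRingCat.of (HomogeneousLocalization.Away 𝒜 f) ⟶ B) (g : Spec B ⟶ Proj 𝒜)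
    (hg : g = Spec.map φ ≫ Proj.awayι 𝒜 f hf hm) (e : ⊤ ≤ g ⁻¹ᵁ Proj.basicOpen 𝒜 f) :
    Proj.awayToSection 𝒜 f ≫ g.appLE (Proj.basicOpen 𝒜 f) ⊤ e =
      φ ≫ (Scheme.ΓSpecIso B).inv := by
  subst hg
  have e₁ : ⊤ ≤ Proj.awayι 𝒜 f hf hm ⁻¹ᵁ Proj.basicOpen 𝒜 f := by
    rw [← Proj.opensRange_awayι 𝒜 f hf hm]; simp
  rw [← Scheme.Hom.appLE_comp_appLE _ _ _ ⊤ ⊤ e₁ le_top, ← Category.assoc,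
    awayToSection_comp_appLE_awayι, Scheme.ΓSpecIso_inv_naturality]
  simp [Scheme.Hom.app_eq_appLE]

theorem preimage_basicOpen_eq_top {f : A} {m : ℕ} (hf : f ∈ 𝒜 m) (hm : 0 < m) {X : Scheme.{u}}
    (h : X ⟶ Spec (.of (HomogeneousLocalization.Away 𝒜 f))) :
    (h ≫ Proj.awayι 𝒜 f hf hm) ⁻¹ᵁ Proj.basicOpen 𝒜 f = ⊤ := by
  rw [Scheme.Hom.comp_preimage, ← Proj.opensRange_awayι 𝒜 f hf hm]
  simp

theorem preimage_basicOpen_eq_bot {f g : A} {m m' : ℕ} (hf : f ∈ 𝒜 m) (hm : 0 < m)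
    (hg : g ∈ 𝒜 m') (hm' : 0 < m') {B : CommRingCat.{u}}
    (φ : CommRingCat.of (HomogeneousLocalization.Away 𝒜 f) ⟶ B)
    (hφ : IsNilpotent (φ (HomogeneousLocalization.Away.isLocalizationElem hf hg))) :
    (Spec.map φ ≫ Proj.awayι 𝒜 f hf hm) ⁻¹ᵁ Proj.basicOpen 𝒜 g = ⊥ := by
  rw [Scheme.Hom.comp_preimage, Proj.awayι_preimage_basicOpen 𝒜 hf hm hg hm']
  exact (PrimeSpectrum.comap_basicOpen φ.hom _).trans
    ((PrimeSpectrum.basicOpen_eq_bot_iff _).mpr hφ)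
end Graded

/-! ### Morphisms to projective space given by coordinates, and their images -/

section Point

variable {K : Type u} [Field K] {n : ℕ} {B : Type u} [CommRing B] [Algebra K B] (b : Fin (n + 1) → B)

local notation "𝒮" => MvPolynomial.homogeneousSubmodule (Fin (n + 1)) K

/-- Evaluation at `b` of the homogeneous fractions with denominator a power of `g`. -/
def evalAway {g : MvPolynomial (Fin (n + 1)) K} (hg : IsUnit (MvPolynomial.aeval b g)) :
    HomogeneousLocalization.Away 𝒮 g →+* B :=
  (IsLocalization.Away.lift (S := Localization.Away g) (g := (MvPolynomial.aeval b).toRingHom) g hg).comp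
    (algebraMap _ (Localization.Away g))

/-- The denominator is cleared, so that computations with `evalAway` become identities between
values of polynomials. -/
theorem evalAway_mk_mul {g : MvPolynomial (Fin (n + 1)) K} (hg : IsUnit (MvPolynomial.aeval b g))
    {d : ℕ} (hd : g ∈ 𝒮 d) (k : ℕ) (F : MvPolynomial (Fin (n + 1)) K) (hF : F ∈ 𝒮 (k • d)) :
    evalAway b hg (HomogeneousLocalization.Away.mk 𝒮 hd k F hF) * MvPolynomial.aeval b g ^ k =
      MvPolynomial.aeval b F := by
  have h : ∀ G, IsLocalization.Away.lift (S := Localization.Away g)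
    (g := (MvPolynomial.aeval b).toRingHom) g hg (algebraMap _ _ G) = MvPolynomial.aeval b G :=
    fun G => IsLocalization.Away.lift_eq g hg G
  rw [evalAway, RingHom.comp_apply, HomogeneousLocalization.algebraMap_apply,
    HomogeneousLocalization.Away.val_mk, ← map_pow, ← h (g ^ k), ← map_mul, ← h F]
  congr 1
  rw [Localization.mk_eq_mk', IsLocalization.mk'_spec]

theorem evalAway_comp_awayMap {g h x : MvPolynomial (Fin (n + 1)) K} {d e : ℕ} (hgd : g ∈ 𝒮 d)
    (hhe : h ∈ 𝒮 e) (hx : x = g * h)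
    (hg : IsUnit (MvPolynomial.aeval b g)) (hxu : IsUnit (MvPolynomial.aeval b x)) :
    (evalAway b hxu).comp (HomogeneousLocalization.awayMap 𝒮 hhe hx) = evalAway b hg := by
  ext z
  obtain ⟨k, F, hF, rfl⟩ := HomogeneousLocalization.Away.mk_surjective 𝒮 hgd z
  have hh : IsUnit (MvPolynomial.aeval b h) := by
    subst hx; rw [map_mul] at hxu; exact isUnit_of_mul_isUnit_right hxu
  rw [RingHom.comp_apply, HomogeneousLocalization.awayMap_mk]
  refine (hxu.pow k).mul_right_cancel ?_
  rw [evalAway_mk_mul, hx, map_mul, map_mul, mul_pow, ← mul_assoc, evalAway_mk_mul, map_pow]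

theorem X_mem_homogeneousSubmodule_one (K : Type u) [Field K] (i : Fin (n + 1)) :
    MvPolynomial.X i ∈ MvPolynomial.homogeneousSubmodule (Fin (n + 1)) K 1 :=
  MvPolynomial.isHomogeneous_X K i

theorem isUnit_aeval_X {i : Fin (n + 1)} (hi : IsUnit (b i)) :
    IsUnit (MvPolynomial.aeval (R := K) b (MvPolynomial.X i)) := by
  rwa [MvPolynomial.aeval_X]

/-- The morphism `Spec B ⟶ ℙⁿ` with homogeneous coordinates `b`, where `b 0` is a unit. -/
def pointMap (h0 : IsUnit (b 0)) : Spec (.of B) ⟶ ProjectiveNSpace K n :=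
  Spec.map (CommRingCat.ofHom (evalAway b (isUnit_aeval_X (K := K) b h0))) ≫
    Proj.awayι 𝒮 (MvPolynomial.X 0) (X_mem_homogeneousSubmodule_one K 0) one_pos

/-- The evaluations on D₊(x₀) and D₊(xᵢ) both factor through D₊(x₀xᵢ), where they coincide. -/
theorem pointMap_eq (h0 : IsUnit (b 0)) {i : Fin (n + 1)} (hi : IsUnit (b i)) :
    pointMap (K := K) b h0 =
      Spec.map (CommRingCat.ofHom (evalAway b (isUnit_aeval_X (K := K) b hi))) ≫
        Proj.awayι 𝒮 (MvPolynomial.X i) (X_mem_homogeneousSubmodule_one K i) one_pos := by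
  have hX : IsUnit (MvPolynomial.aeval (R := K) b (MvPolynomial.X 0 * MvPolynomial.X i)) := by
    rw [map_mul, MvPolynomial.aeval_X, MvPolynomial.aeval_X]; exact h0.mul hi
  rw [pointMap, ← evalAway_comp_awayMap b (X_mem_homogeneousSubmodule_one K 0)
    (X_mem_homogeneousSubmodule_one K i) rfl _ hX, ← evalAway_comp_awayMap b
    (X_mem_homogeneousSubmodule_one K i) (X_mem_homogeneousSubmodule_one K 0) (mul_comm _ _) _ hX,
    CommRingCat.ofHom_comp, CommRingCat.ofHom_comp, Spec.map_comp, Spec.map_comp, Category.assoc,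
    Category.assoc, Proj.SpecMap_awayMap_awayι, Proj.SpecMap_awayMap_awayι]

variable (h0 : IsUnit (b 0))

theorem preimage_chart_eq_top {i : Fin (n + 1)} (hi : IsUnit (b i)) :
    pointMap (K := K) b h0 ⁻¹ᵁ chart K n i = ⊤ := by
  rw [pointMap_eq b h0 hi]
  exact preimage_basicOpen_eq_top 𝒮 _ _ _

theorem preimage_chart_eq_bot {i : Fin (n + 1)} (hi : IsNilpotent (b i)) :
    pointMap (K := K) b h0 ⁻¹ᵁ chart K n i = ⊥ := by
  refine preimage_basicOpen_eq_bot 𝒮 _ _ (X_mem_homogeneousSubmodule_one K i) one_pos _ ?_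
  have h := evalAway_mk_mul b (isUnit_aeval_X (K := K) b h0) (X_mem_homogeneousSubmodule_one K 0) 1
    (MvPolynomial.X i ^ 1) (by simpa using MvPolynomial.isHomogeneous_X K i)
  have h2 := (isUnit_aeval_X (K := K) b h0).pow 1
  have hi' : IsNilpotent (MvPolynomial.aeval (R := K) b (MvPolynomial.X i ^ 1)) := by simpa using hi
  rw [← h] at hi'
  obtain ⟨k, hk⟩ := hi'
  rw [mul_pow] at hk
  exact ⟨k, (h2.pow k).mul_left_eq_zero.mp hk⟩

theorem pointMap_appLE {i : Fin (n + 1)} (hi : IsUnit (b i))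
    (e : ⊤ ≤ pointMap (K := K) b h0 ⁻¹ᵁ chart K n i) :
    Proj.awayToSection 𝒮 (MvPolynomial.X i) ≫ (pointMap (K := K) b h0).appLE (chart K n i) ⊤ e =
      CommRingCat.ofHom (evalAway b (isUnit_aeval_X (K := K) b hi)) ≫
        (Scheme.ΓSpecIso (.of B)).inv :=
  awayToSection_comp_appLE 𝒮 _ _ _ _ (pointMap_eq b h0 hi) e

/-- Functions on an affine open of a scheme-theoretic image inject into functions on its preimage,
here all of `Spec B`. Equations on the image can thus be tested in `B`. -/
theorem exists_specHom_injective {i : Fin (n + 1)} (hi : IsUnit (b i)) :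
    ∃ ψ : Γ((pointMap (K := K) b h0).image, (pointMap (K := K) b h0).imageι ⁻¹ᵁ chart K n i) →+* B,
      Function.Injective ψ ∧ ∀ z, ψ ((pointMap (K := K) b h0).imageι.app (chart K n i)
        (Proj.awayToSection 𝒮 (MvPolynomial.X i) z)) =
          evalAway b (isUnit_aeval_X (K := K) b hi) z := by
  have hU : IsAffineOpen (chart K n i) :=
    Proj.isAffineOpen_basicOpen 𝒮 _ (X_mem_homogeneousSubmodule_one K i) one_pos
  have hall := pointMap_appLE (K := K) b h0 hi
  set f := pointMap (K := K) b h0 with hf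
  have hV : f.toImage ⁻¹ᵁ (f.imageι ⁻¹ᵁ chart K n i) = ⊤ := by
    rw [← Scheme.Hom.comp_preimage, Scheme.Hom.toImage_imageι, preimage_chart_eq_top b h0 hi]
  have hinj := f.toImage_app_injective ⟨chart K n i, hU⟩
  let χ : Γ(Spec (.of B), f.toImage ⁻¹ᵁ (f.imageι ⁻¹ᵁ chart K n i)) ≅ CommRingCat.of B :=
    (Spec (.of B)).presheaf.mapIso (eqToIso hV.symm).op ≪≫ Scheme.ΓSpecIso (.of B)
  have hχ : Function.Injective χ.hom := χ.commRingCatIsoToRingEquiv.injective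
  refine ⟨(f.toImage.app _ ≫ χ.hom).hom, ?_, ?_⟩
  · rw [CommRingCat.hom_comp]
    exact hχ.comp hinj
  · intro z
    have h := hall (preimage_chart_eq_top (K := K) b h0 hi).ge
    rw [Iso.eq_comp_inv] at h
    have h3 : f.imageι.app (chart K n i) ≫ f.toImage.app (f.imageι ⁻¹ᵁ chart K n i) ≫ χ.hom =
      f.appLE (chart K n i) ⊤ (preimage_chart_eq_top (K := K) b h0 hi).ge ≫ (Scheme.ΓSpecIso (.of B)).hom := by
      rw [appLE_eq_of_eq_comp f.toImage_imageι.symm _ _ _ hV.ge, Category.assoc, Scheme.Hom.appLE,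
        Category.assoc]
      rfl
    have h4 := congrArg (fun q => (CommRingCat.Hom.hom q) z) h
    rw [Category.assoc, ← h3] at h4
    exact h4

/-- A unit coordinate puts all of `Spec B` in the chart, a nilpotent one puts nothing there; so each
chart either tests the value of the form in `B` or imposes no condition. -/
theorem mem_vanishingForms_imageι (hb : ∀ i, IsUnit (b i) ∨ IsNilpotent (b i)) {m : ℕ}
    (F : MvPolynomial.homogeneousSubmodule (Fin (n + 1)) K m) :
    F ∈ vanishingForms (pointMap (K := K) b h0).imageι m ↔
      MvPolynomial.aeval b (F : MvPolynomial (Fin (n + 1)) K) = 0 := by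
  have key : ∀ i, IsUnit (b i) → ((pointMap (K := K) b h0).imageι.app (chart K n i)
      (dehomogenize F i) = 0 ↔ MvPolynomial.aeval b (F : MvPolynomial (Fin (n + 1)) K) = 0) := by
    intro i hi
    obtain ⟨ψ, hψ, h⟩ := exists_specHom_injective (K := K) b h0 hi
    rw [← map_eq_zero_iff ψ hψ, dehomogenize, h]
    have h2 := evalAway_mk_mul b (isUnit_aeval_X (K := K) b hi)
      (X_mem_homogeneousSubmodule_one K i) m F.1 (by simp)
    rw [← h2]
    exact (((isUnit_aeval_X (K := K) b hi).pow m).mul_left_eq_zero).symm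
  refine ⟨fun h => (key 0 h0).mp (h 0), fun h i => ?_⟩
  obtain hi | hi := hb i
  · exact (key i hi).mpr h
  · have hU : IsAffineOpen (chart K n i) :=
      Proj.isAffineOpen_basicOpen 𝒮 _ (X_mem_homogeneousSubmodule_one K i) one_pos
    have hinj := (pointMap (K := K) b h0).toImage_app_injective ⟨chart K n i, hU⟩
    have hV : (pointMap (K := K) b h0).toImage ⁻¹ᵁ
        ((pointMap (K := K) b h0).imageι ⁻¹ᵁ chart K n i) = ⊥ := by
      rw [← Scheme.Hom.comp_preimage, Scheme.Hom.toImage_imageι, preimage_chart_eq_bot b h0 hi]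
    have : Subsingleton Γ(Spec (.of B), (pointMap (K := K) b h0).toImage ⁻¹ᵁ
        ((pointMap (K := K) b h0).imageι ⁻¹ᵁ chart K n i)) := by
      rw [hV]; infer_instance
    exact hinj (Subsingleton.elim _ _)

end Point

/-! ### A criterion for the image to be a curve -/

section Curve

variable {K : Type u} [Field K] {n : ℕ}

theorem adjoin_range_X (K : Type u) [Field K] (n : ℕ) :
    Algebra.adjoin (MvPolynomial.homogeneousSubmodule (Fin (n + 1)) K 0)
      (Set.range (MvPolynomial.X : Fin (n + 1) → MvPolynomial (Fin (n + 1)) K)) = ⊤ := by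
  refine eq_top_iff.mpr fun p _ => ?_
  induction p using MvPolynomial.induction_on with
  | C a =>
    exact Subalgebra.algebraMap_mem _ (⟨MvPolynomial.C a, MvPolynomial.isHomogeneous_C _ a⟩ :
      MvPolynomial.homogeneousSubmodule (Fin (n + 1)) K 0)
  | add p q hp hq => exact add_mem (hp trivial) (hq trivial)
  | mul_X p i hp => exact mul_mem (hp trivial) (Algebra.subset_adjoin ⟨i, rfl⟩)

theorem iSup_chart (K : Type u) [Field K] (n : ℕ) : ⨆ i, chart K n i = ⊤ :=
  Proj.iSup_basicOpen_eq_top' _ _ (fun i => ⟨1, X_mem_homogeneousSubmodule_one K i⟩)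
    (adjoin_range_X K n)

theorem isNoetherianRing_away (g : MvPolynomial (Fin (n + 1)) K) {m : ℕ}
    (hg : g ∈ MvPolynomial.homogeneousSubmodule (Fin (n + 1)) K m) :
    IsNoetherianRing
      (HomogeneousLocalization.Away (MvPolynomial.homogeneousSubmodule (Fin (n + 1)) K) g) := by
  have : Algebra.FiniteType (MvPolynomial.homogeneousSubmodule (Fin (n + 1)) K 0)
      (MvPolynomial (Fin (n + 1)) K) :=
    ⟨Subalgebra.fg_def.mpr ⟨_, Set.finite_range _, adjoin_range_X K n⟩⟩
  have := HomogeneousLocalization.Away.finiteType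
    (𝒜 := MvPolynomial.homogeneousSubmodule (Fin (n + 1)) K) g m hg
  exact Algebra.FiniteType.isNoetherianRing
    (MvPolynomial.homogeneousSubmodule (Fin (n + 1)) K 0) _

/-- Irreducible closed subsets correspond to their generic points, and the coheight of a point is
the dimension of its stalk. -/
theorem topologicalKrullDim_le_of_ringKrullDim_stalk_le (X : Scheme.{u}) (r : WithBot ℕ∞)
    (h : ∀ x : X, ringKrullDim (X.presheaf.stalk x) ≤ r) : topologicalKrullDim X ≤ r := by
  rw [topologicalKrullDim, Order.krullDim_eq_of_orderIso (irreducibleSetEquivPoints (α := X)),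
    Order.krullDim_eq_iSup_coheight]
  refine iSup_le fun x => ?_
  have := h x
  rw [ringKrullDim_stalk_eq_coheight] at this
  exact this

theorem ringKrullDim_le_topologicalKrullDim {X : Scheme.{u}} {U : X.Opens} (hU : IsAffineOpen U) :
    ringKrullDim Γ(X, U) ≤ topologicalKrullDim X := by
  rw [← PrimeSpectrum.topologicalKrullDim_eq_ringKrullDim]
  exact hU.fromSpec.isOpenEmbedding.isInducing.topologicalKrullDim_le

theorem hasPureDimension_of_irreducibleSpace (X : Scheme.{u}) [IrreducibleSpace X] (r : ℕ)
    (h : topologicalKrullDim X = r) : HasPureDimension X r := by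
  intro Z hZ
  rw [irreducibleComponents_eq_singleton] at hZ
  obtain rfl := hZ
  rw [← h]
  exact IsHomeomorph.topologicalKrullDim_eq _ (Homeomorph.Set.univ X).isHomeomorph

variable {B : Type u} [CommRing B] [Algebra K B] (b : Fin (n + 1) → B) (h0 : IsUnit (b 0))
  {L : Type*} [Field L] (ρ : B →+* L)

theorem irreducibleSpace_spec (hker : RingHom.ker ρ ≤ nilradical B) :
    IrreducibleSpace (Spec (CommRingCat.of B)) := by
  refine PrimeSpectrum.irreducibleSpace_iff_isPrime_nilradical.mpr ?_
  have : nilradical B = RingHom.ker ρ :=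
    le_antisymm (have := RingHom.ker_isPrime ρ; nilradical_le_prime _) hker
  rw [this]
  exact RingHom.ker_isPrime ρ

theorem irreducibleSpace_of_isDominant {X Y : Scheme.{u}} (f : X ⟶ Y) [IsDominant f]
    [IrreducibleSpace X] : IrreducibleSpace Y := by
  have h := ((IrreducibleSpace.isIrreducible_univ X).image f f.continuous.continuousOn).closure
  rw [Set.image_univ, f.denseRange.closure_range] at h
  exact (irreducibleSpace_def Y).mpr h

/-- Everything is pulled back along the injection into `B`: the kernel is nilpotent because that of
`ρ` is, and an element with nonzero image is regular because it becomes a unit in `B`. Noetherianity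
comes from being a quotient of the chart's ring. -/
theorem exists_surjective_polynomial (hker : RingHom.ker ρ ≤ nilradical B)
    {i : Fin (n + 1)} (hi : IsUnit (b i)) (j : Polynomial K →+* L) (hj : Function.Injective j)
    (hrange : (ρ.comp (evalAway (K := K) b (isUnit_aeval_X b hi))).range = j.range)
    (hunit : ∀ x, ρ x ≠ 0 → IsUnit x) :
    IsNoetherianRing Γ((pointMap (K := K) b h0).image,
        (pointMap (K := K) b h0).imageι ⁻¹ᵁ chart K n i) ∧
    ∃ σ : Γ((pointMap (K := K) b h0).image,
        (pointMap (K := K) b h0).imageι ⁻¹ᵁ chart K n i) →+* Polynomial K,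
      Function.Surjective σ ∧ RingHom.ker σ ≤ nilradical _ ∧
        ∀ a, σ a ≠ 0 → a ∈ nonZeroDivisors _ := by
  obtain ⟨ψ, hψ, h⟩ := exists_specHom_injective (K := K) b h0 hi
  have hU : IsAffineOpen (chart K n i) :=
    Proj.isAffineOpen_basicOpen _ _ (X_mem_homogeneousSubmodule_one K i) one_pos
  have hsurj : Function.Surjective fun z => (pointMap (K := K) b h0).imageι.app (chart K n i)
        (Proj.awayToSection _ (MvPolynomial.X i) z) :=
    ((pointMap (K := K) b h0).ker.subschemeι_app_surjective ⟨_, hU⟩).comp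
      (Proj.basicOpenIsoAway _ _ (X_mem_homogeneousSubmodule_one K i)
        one_pos).commRingCatIsoToRingEquiv.surjective
  refine ⟨?_, ?_⟩
  · have := isNoetherianRing_away _ (X_mem_homogeneousSubmodule_one K i)
    exact isNoetherianRing_of_surjective _ _
      ((Proj.awayToSection _ (MvPolynomial.X i)) ≫
        (pointMap (K := K) b h0).imageι.app (chart K n i)).hom hsurj
  · have hr : (ρ.comp ψ).range = j.range := by
      rw [← hrange]
      ext y
      constructor
      · rintro ⟨a, rfl⟩
        obtain ⟨z, rfl⟩ := hsurj a
        exact ⟨z, by simp [h]⟩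
      · rintro ⟨z, rfl⟩
        exact ⟨_, by rw [RingHom.comp_apply, h z]; rfl⟩
    let e : Polynomial K ≃+* j.range := RingEquiv.ofBijective j.rangeRestrict
      ⟨fun x y hxy => hj (congrArg Subtype.val hxy), j.rangeRestrict_surjective⟩
    let σ : Γ((pointMap (K := K) b h0).image,
        (pointMap (K := K) b h0).imageι ⁻¹ᵁ chart K n i) →+* Polynomial K :=
      e.symm.toRingHom.comp ((ρ.comp ψ).codRestrict j.range fun x => hr ▸ ⟨x, rfl⟩)
    have hσ : ∀ a, j (σ a) = ρ (ψ a) := fun a => by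
      have : e (σ a) = (ρ.comp ψ).codRestrict j.range (fun x => hr ▸ ⟨x, rfl⟩) a :=
        e.apply_symm_apply _
      exact congrArg Subtype.val this
    refine ⟨σ, fun p => ?_, fun a ha => ?_, fun a ha => ?_⟩
    · obtain ⟨a, ha⟩ : j p ∈ (ρ.comp ψ).range := hr ▸ ⟨p, rfl⟩
      exact ⟨a, hj ((hσ a).trans ha)⟩
    · have : ρ (ψ a) = 0 := by rw [← hσ, RingHom.mem_ker.mp ha, map_zero]
      obtain ⟨k, hk⟩ := mem_nilradical.mp (hker (RingHom.mem_ker.mpr this))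
      exact mem_nilradical.mpr ⟨k, hψ (by rw [map_pow, hk, map_zero])⟩
    · have hu : IsUnit (ψ a) := hunit _ (by rwa [← hσ, Ne, map_eq_zero_iff j hj])
      refine mem_nonZeroDivisors_iff_right.mpr fun x hx => hψ ?_
      rw [map_zero]
      refine hu.mul_left_eq_zero.mp ?_
      rw [← map_mul, hx, map_zero]

theorem isCurve_imageι (hker : RingHom.ker ρ ≤ nilradical B) (hunit : ∀ x, ρ x ≠ 0 → IsUnit x)
    (h : ∀ i, IsNilpotent (b i) ∨ ∃ (hi : IsUnit (b i)) (j : Polynomial K →+* L),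
      Function.Injective j ∧
        (ρ.comp (evalAway (K := K) b (isUnit_aeval_X b hi))).range = j.range) :
    IsCurve (pointMap (K := K) b h0).imageι := by
  have hB : IrreducibleSpace (Spec (CommRingCat.of B)) := irreducibleSpace_spec ρ hker
  have hC : IrreducibleSpace (pointMap (K := K) b h0).image :=
    irreducibleSpace_of_isDominant (pointMap (K := K) b h0).toImage
  have hR := Polynomial.not_isField K
  have hstalk : ∀ x : (pointMap (K := K) b h0).image,
      IsCohenMacaulayLocalRing ((pointMap (K := K) b h0).image.presheaf.stalk x) ∧
      ringKrullDim ((pointMap (K := K) b h0).image.presheaf.stalk x) ≤ 1 := by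
    intro x
    obtain ⟨i, hxi⟩ : ∃ i, x ∈ (pointMap (K := K) b h0).imageι ⁻¹ᵁ chart K n i := by
      have : (pointMap (K := K) b h0).imageι x ∈ ⨆ i, chart K n i := by
        rw [iSup_chart]; trivial
      obtain ⟨i, hi⟩ := TopologicalSpace.Opens.mem_iSup.mp this
      exact ⟨i, hi⟩
    have hU : IsAffineOpen ((pointMap (K := K) b h0).imageι ⁻¹ᵁ chart K n i) :=
      (Proj.isAffineOpen_basicOpen _ _ (X_mem_homogeneousSubmodule_one K i) one_pos).preimage _
    obtain hi | ⟨hi, j, hj, hrange⟩ := h i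
    -- The image of `Spec B` is dense in the curve and misses this chart, so the curve misses it
    -- too.
    · exfalso
      obtain ⟨y, hy⟩ := (pointMap (K := K) b h0).toImage.denseRange.exists_mem_open
        ((pointMap (K := K) b h0).imageι ⁻¹ᵁ chart K n i).isOpen ⟨x, hxi⟩
      have : y ∈ pointMap (K := K) b h0 ⁻¹ᵁ chart K n i := by
        rw [← Scheme.Hom.toImage_imageι (pointMap (K := K) b h0)]
        exact hy
      rw [preimage_chart_eq_bot b h0 hi] at this
      exact this
    · obtain ⟨hN, σ, hσ, hσk, hσr⟩ :=
        exists_surjective_polynomial b h0 ρ hker hi j hj hrange hunit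
      let := (pointMap (K := K) b h0).image.presheaf.algebra_section_stalk ⟨x, hxi⟩
      have hloc := hU.isLocalization_stalk ⟨x, hxi⟩
      refine ⟨isCohenMacaulayLocalRing_of_isLocalization σ hσ hσk hσr hR
        (hU.primeIdealOf ⟨x, hxi⟩).asIdeal _, ?_⟩
      rw [IsLocalization.AtPrime.ringKrullDim_eq_height (hU.primeIdealOf ⟨x, hxi⟩).asIdeal,
        ← ringKrullDim_eq_one_of_surjective σ hσ hσk hR]
      exact Ideal.height_le_ringKrullDim_of_ne_top Ideal.IsPrime.ne_top'
  refine ⟨inferInstance, fun x => (hstalk x).1, ?_⟩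
  refine hasPureDimension_of_irreducibleSpace _ 1 (le_antisymm
    (topologicalKrullDim_le_of_ringKrullDim_stalk_le _ _ fun x => (hstalk x).2) ?_)
  -- The chart at coordinate 0 supplies the lower bound on the dimension.
  have hU : IsAffineOpen ((pointMap (K := K) b h0).imageι ⁻¹ᵁ chart K n 0) :=
      (Proj.isAffineOpen_basicOpen _ _ (X_mem_homogeneousSubmodule_one K 0) one_pos).preimage _
  obtain hi | ⟨hi, j, hj, hrange⟩ := h 0
  · exact absurd (hi.map ρ).eq_zero (h0.map ρ).ne_zero
  obtain ⟨hN, σ, hσ, hσk, hσr⟩ :=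
        exists_surjective_polynomial b h0 ρ hker hi j hj hrange hunit
  rw [Nat.cast_one, ← ringKrullDim_eq_one_of_surjective σ hσ hσk hR]
  exact ringKrullDim_le_topologicalKrullDim hU

end Curve

/-! ### Images of evaluation maps -/

section EvalRange

variable {K : Type u} [Field K] {n : ℕ} {B : Type u} [CommRing B] [Algebra K B]
  (b : Fin (n + 1) → B) {L : Type*} [Field L] [Algebra K L]

theorem isHomogeneous_aeval_mul {m : ℕ} {F : MvPolynomial (Fin (n + 1)) K} (hF : F.IsHomogeneous m)
    {S : Type*} [CommRing S] [Algebra K S] (c : S) (x : Fin (n + 1) → S) :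
    MvPolynomial.aeval (fun k => c * x k) F = c ^ m * MvPolynomial.aeval x F := by
  rw [MvPolynomial.aeval_def, MvPolynomial.aeval_def, MvPolynomial.eval₂_eq, MvPolynomial.eval₂_eq,
    Finset.mul_sum]
  refine Finset.sum_congr rfl fun s hs => ?_
  rw [hF.degree_eq_sum_deg_support hs, Finset.prod_congr rfl fun i _ => mul_pow c (x i) (s i),
    Finset.prod_mul_distrib, Finset.prod_pow_eq_pow_sum]
  ring

/-- All coordinate ratios are polynomials in `z`, and `z` itself is one of them, so the degree-zero
fractions generate exactly K[z]. -/
theorem range_comp_evalAway (ρ : B →ₐ[K] L) {i : Fin (n + 1)} (hi : IsUnit (b i)) (z : L)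
    (hz : ∀ k, ∃ p : Polynomial K, ρ (b k) = ρ (b i) * Polynomial.aeval z p) (k₀ : Fin (n + 1))
    (hk₀ : ρ (b k₀) = ρ (b i) * z) :
    ((ρ : B →+* L).comp (evalAway (K := K) b (isUnit_aeval_X b hi))).range =
      (Polynomial.aeval (R := K) z : Polynomial K →+* L).range := by
  have hρ : ρ (b i) ≠ 0 := (hi.map ρ).ne_zero
  have key : ∀ m F (hF : F ∈ MvPolynomial.homogeneousSubmodule (Fin (n + 1)) K (m • 1)),
      ρ (evalAway b (isUnit_aeval_X (K := K) b hi) (HomogeneousLocalization.Away.mk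
        (MvPolynomial.homogeneousSubmodule (Fin (n + 1)) K)
        (X_mem_homogeneousSubmodule_one K i) m F hF)) * ρ (b i) ^ m =
        MvPolynomial.aeval (fun k => ρ (b k)) F := by
    intro m F hF
    have := congrArg ρ (evalAway_mk_mul b (isUnit_aeval_X (K := K) b hi)
      (X_mem_homogeneousSubmodule_one K i) m F hF)
    rw [map_mul, map_pow, MvPolynomial.aeval_X] at this
    rw [this, ← MvPolynomial.comp_aeval_apply]
  choose p hp using hz
  apply le_antisymm
  · rintro _ ⟨x, rfl⟩
    obtain ⟨m, F, hF, rfl⟩ := HomogeneousLocalization.Away.mk_surjective _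
      (X_mem_homogeneousSubmodule_one K i) x
    refine ⟨MvPolynomial.aeval p F, mul_right_cancel₀ (pow_ne_zero m hρ) ?_⟩
    refine Eq.trans ?_ (key m F hF).symm
    have hF' : F.IsHomogeneous m := by simpa using hF
    rw [funext hp, isHomogeneous_aeval_mul hF', mul_comm]
    exact congrArg _ (MvPolynomial.comp_aeval_apply p (Polynomial.aeval z) F)
  · rintro _ ⟨q, rfl⟩
    change Polynomial.aeval z q ∈ _
    induction q using Polynomial.induction_on' with
    | add q r hq hr => rw [map_add]; exact add_mem hq hr
    | monomial e c =>
      rw [Polynomial.aeval_monomial]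
      refine mul_mem ?_ (pow_mem ?_ e)
      · refine ⟨HomogeneousLocalization.Away.mk _ (X_mem_homogeneousSubmodule_one K i) 0
          (MvPolynomial.C c) (by simp), ?_⟩
        have := key 0 (MvPolynomial.C c) (by simp)
        rw [pow_zero, mul_one, MvPolynomial.aeval_C] at this
        exact this
      · refine ⟨HomogeneousLocalization.Away.mk _ (X_mem_homogeneousSubmodule_one K i) 1
          (MvPolynomial.X k₀) (by simpa using MvPolynomial.isHomogeneous_X K k₀), ?_⟩
        have := key 1 (MvPolynomial.X k₀) (by simp [MvPolynomial.isHomogeneous_X])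
        rw [pow_one, MvPolynomial.aeval_X, hk₀, mul_comm] at this
        exact mul_left_cancel₀ hρ this

theorem hilbertFunction_eq_finrank_range (h0 : IsUnit (b 0))
    (hb : ∀ i, IsUnit (b i) ∨ IsNilpotent (b i)) (m : ℕ) :
    hilbertFunction (pointMap (K := K) b h0).imageι m =
      Module.finrank K (LinearMap.range ((MvPolynomial.aeval (R := K) b).toLinearMap.comp
        (MvPolynomial.homogeneousSubmodule (Fin (n + 1)) K m).subtype)) := by
  have : vanishingForms (pointMap (K := K) b h0).imageι m =
      LinearMap.ker ((MvPolynomial.aeval (R := K) b).toLinearMap.comp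
        (MvPolynomial.homogeneousSubmodule (Fin (n + 1)) K m).subtype) := by
    ext F
    exact mem_vanishingForms_imageι b h0 hb F
  rw [hilbertFunction, this]
  exact (LinearMap.quotKerEquivRange _).finrank_eq

end EvalRange

/-! ### The ring of jets L[y]/(y^d) and its monomials -/

section Jet

variable {K : Type u} [Field K] {L : Type u} [Field L] [Algebra K L] (d : ℕ) (t : L)

/-- The ring `L[y] / (y ^ d)` of jets. -/
abbrev Jet (L : Type u) [Field L] (d : ℕ) : Type u :=
  AdjoinRoot (Polynomial.X ^ d : Polynomial L)

/-- The element `t ^ e * y ^ w` of `L[y] / (y ^ d)`. -/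
def jetMonomial (e : ℤ) (w : ℕ) : Jet L d :=
  AdjoinRoot.mk _ (Polynomial.C (t ^ e) * Polynomial.X ^ w)

variable {d t}

theorem jetMonomial_mul (ht : t ≠ 0) (e e' : ℤ) (w w' : ℕ) :
    jetMonomial d t e w * jetMonomial d t e' w' = jetMonomial d t (e + e') (w + w') := by
  rw [jetMonomial, jetMonomial, jetMonomial, ← map_mul, zpow_add₀ ht, Polynomial.C_mul]
  congr 1
  ring

theorem jetMonomial_zero : jetMonomial d t 0 0 = 1 := by
  simp [jetMonomial]

theorem jetMonomial_pow (ht : t ≠ 0) (e : ℤ) (w k : ℕ) :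
    jetMonomial d t e w ^ k = jetMonomial d t (k * e) (k * w) := by
  induction k with
  | zero => simp [jetMonomial_zero]
  | succ k ih => rw [pow_succ, ih, jetMonomial_mul ht]; congr 1 <;> push_cast <;> ring

theorem jetMonomial_eq_zero (e : ℤ) {w : ℕ} (hw : d ≤ w) : jetMonomial d t e w = 0 := by
  rw [jetMonomial, AdjoinRoot.mk_eq_zero]
  exact (pow_dvd_pow _ hw).mul_left _

theorem isUnit_jetMonomial (ht : t ≠ 0) (e : ℤ) : IsUnit (jetMonomial d t e 0) :=
  IsUnit.of_mul_eq_one (jetMonomial d t (-e) 0) (by simp [jetMonomial_mul ht, jetMonomial_zero])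

theorem isNilpotent_jetMonomial (ht : t ≠ 0) (e : ℤ) {w : ℕ} (hw : 0 < w) :
    IsNilpotent (jetMonomial d t e w) :=
  ⟨d, by rw [jetMonomial_pow ht]; exact jetMonomial_eq_zero _ (Nat.le_mul_of_pos_right d hw)⟩

theorem prod_jetMonomial (ht : t ≠ 0) {ι : Type*} (s : Finset ι) (e : ι → ℤ) (w : ι → ℕ) :
    ∏ i ∈ s, jetMonomial d t (e i) (w i) = jetMonomial d t (∑ i ∈ s, e i) (∑ i ∈ s, w i) := by
  classical
  induction s using Finset.induction_on with
  | empty => simp [jetMonomial_zero]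
  | insert a s ha ih => rw [Finset.prod_insert ha, ih, jetMonomial_mul ht, Finset.sum_insert ha,
      Finset.sum_insert ha]

/-- The coefficient of each y^w with w < d survives modulo y^d, which reduces the claim to the
powers of `t`. -/
theorem linearIndependent_jetMonomial (hT : LinearIndependent K fun e : ℤ => t ^ e) :
    LinearIndependent K fun x : Fin d × ℤ => jetMonomial d t x.2 x.1 := by
  classical
  rw [linearIndependent_iff']
  intro s c h x hx
  have h2 : AdjoinRoot.mk (Polynomial.X ^ d : Polynomial L)
      (∑ y ∈ s, c y • (Polynomial.C (t ^ y.2) * Polynomial.X ^ (y.1 : ℕ))) = 0 := by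
    rw [map_sum, ← h]
    refine Finset.sum_congr rfl fun y _ => ?_
    exact AdjoinRoot.smul_mk _ _ _
  rw [AdjoinRoot.mk_eq_zero, Polynomial.X_pow_dvd_iff] at h2
  have h3 := h2 x.1 x.1.2
  simp only [Polynomial.finsetSum_coeff, Polynomial.coeff_smul, Polynomial.coeff_C_mul,
    Polynomial.coeff_X_pow] at h3
  let F : Finset ℤ := (s.filter fun y => y.1 = x.1).image Prod.snd
  have h4 : ∑ e ∈ F, c (x.1, e) • t ^ e = 0 := by
    rw [← h3, Finset.sum_image, Finset.sum_filter]
    · refine Finset.sum_congr rfl fun y _ => ?_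
      by_cases hy : y.1 = x.1
      · rw [if_pos hy, if_pos (by rw [hy]), mul_one, ← hy]
      · rw [if_neg hy, if_neg (fun h => hy (Fin.ext h.symm)), mul_zero, smul_zero]
    · rintro ⟨w, e⟩ hy ⟨w', e'⟩ hy' h
      have h1 := (Finset.mem_filter.mp hy).2
      have h1' := (Finset.mem_filter.mp hy').2
      exact Prod.ext (h1.trans h1'.symm) h
  exact linearIndependent_iff'.mp hT F (fun e => c (x.1, e)) h4 x.2
    (Finset.mem_image_of_mem _ (Finset.mem_filter.mpr ⟨hx, rfl⟩))

/-- The residue map `L[y] / (y ^ d) → L`. -/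
def jetResidue (K : Type u) [Field K] (L : Type u) [Field L] [Algebra K L] (hd : d ≠ 0) :
    Jet L d →ₐ[K] L :=
  AdjoinRoot.liftAlgHom (Polynomial.X ^ d) (AlgHom.id K L) 0 (by simp [hd])

theorem jetResidue_jetMonomial (hd : d ≠ 0) (e : ℤ) (w : ℕ) :
    jetResidue K L hd (jetMonomial d t e w) = if w = 0 then t ^ e else 0 := by
  simp [jetResidue, jetMonomial, zero_pow_eq]

theorem ker_jetResidue_le (hd : d ≠ 0) :
    RingHom.ker (jetResidue K L hd : Jet L d →+* L) ≤ nilradical (Jet L d) := by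
  intro x hx
  obtain ⟨p, rfl⟩ := AdjoinRoot.mk_surjective x
  have h : p.coeff 0 = 0 := by
    have : p.eval₂ (RingHom.id _) 0 = 0 := by simpa [jetResidue] using hx
    simpa [Polynomial.eval₂_at_zero] using this
  refine mem_nilradical.mpr ⟨d, ?_⟩
  rw [← map_pow, AdjoinRoot.mk_eq_zero]
  exact pow_dvd_pow_of_dvd (Polynomial.X_dvd_iff.mpr h) d

/-- Multiplying by a constant lift of the inverse residue gives 1 plus a nilpotent. -/
theorem isUnit_of_jetResidue_ne_zero (hd : d ≠ 0) (x : Jet L d)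
    (hx : jetResidue K L hd x ≠ 0) : IsUnit x := by
  let y : Jet L d := AdjoinRoot.of _ (jetResidue K L hd x)⁻¹
  have hy : jetResidue K L hd y = (jetResidue K L hd x)⁻¹ := by
    simp [y, jetResidue]
  have : IsNilpotent (x * y - 1) := by
    refine mem_nilradical.mp (ker_jetResidue_le (K := K) hd ?_)
    change jetResidue K L hd (x * y - 1) = 0
    rw [map_sub, map_mul, hy, mul_inv_cancel₀ hx, map_one, sub_self]
  have h := this.isUnit_add_one
  rw [sub_add_cancel] at h
  exact isUnit_of_mul_isUnit_left h

theorem injective_aeval_zpow (hT : LinearIndependent K fun e : ℤ => t ^ e) {e : ℤ} (he : e ≠ 0) :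
    Function.Injective (Polynomial.aeval (R := K) (t ^ e)) := by
  have hLI : LinearIndependent K fun k : ℕ => (t ^ e) ^ k := by
    have : (fun k : ℕ => (t ^ e) ^ k) = (fun e : ℤ => t ^ e) ∘ fun k : ℕ => e * (k : ℤ) := by
      ext k
      simp [zpow_mul]
    rw [this]
    exact hT.comp _ fun k l h => by simpa [he] using h
  rw [injective_iff_map_eq_zero]
  intro p hp
  rw [Polynomial.aeval_eq_sum_range] at hp
  ext k
  by_cases hk : k ∈ Finset.range (p.natDegree + 1)
  · exact linearIndependent_iff'.mp hLI _ _ hp k hk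
  · exact Polynomial.coeff_eq_zero_of_natDegree_lt (by simpa [Nat.lt_succ_iff] using hk)

end Jet

/-! ### The multiple line: exponent count, non-degeneracy, Hilbert polynomial -/

section MultipleLine

variable (r N d : ℕ)

/-- The exponents of `t` in the coordinates of the jet `(1 : t : y : t ^ (-N) * y ^ (d - 1) : ⋯)`. -/
def tExponent : Fin (r + 2 + 1) → ℤ :=
  Fin.cons 0 (Fin.cons 1 (Fin.cons 0 fun i : Fin r => (i : ℤ) - N))

/-- The exponents of `y` in the coordinates of the jet `(1 : t : y : t ^ (-N) * y ^ (d - 1) : ⋯)`. -/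
def yExponent : Fin (r + 2 + 1) → ℕ :=
  Fin.cons 0 (Fin.cons 0 (Fin.cons 1 fun _ : Fin r => d - 1))

variable {r} in
theorem fin_cases_three {P : Fin (r + 2 + 1) → Prop} (h0 : P 0) (h1 : P 1) (h2 : P 2)
    (h : ∀ i : Fin r, P i.succ.succ.succ) (k : Fin (r + 2 + 1)) : P k :=
  Fin.cases h0 (fun k => Fin.cases h1 (fun k => Fin.cases h2 h k) k) k

theorem sum_univ_three {M : Type*} [AddCommMonoid M] (f : Fin (r + 2 + 1) → M) :
    ∑ k, f k = f 0 + (f 1 + (f 2 + ∑ i : Fin r, f i.succ.succ.succ)) := by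
  rw [Fin.sum_univ_succ, Fin.sum_univ_succ, Fin.sum_univ_succ]
  rfl

@[simp] theorem tExponent_zero : tExponent r N 0 = 0 := rfl
@[simp] theorem tExponent_one : tExponent r N 1 = 1 := rfl
@[simp] theorem tExponent_two : tExponent r N 2 = 0 := rfl
@[simp] theorem tExponent_succ (i : Fin r) : tExponent r N i.succ.succ.succ = (i : ℤ) - N := rfl
@[simp] theorem yExponent_zero : yExponent r d 0 = 0 := rfl
@[simp] theorem yExponent_one : yExponent r d 1 = 0 := rfl
@[simp] theorem yExponent_two : yExponent r d 2 = 1 := rfl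
@[simp] theorem yExponent_succ (i : Fin r) : yExponent r d i.succ.succ.succ = d - 1 := rfl

/-- The exponents `(w, e)` of the monomials `y ^ w * t ^ e` that are values of forms of degree `m`
at the jet `(1 : t : y : t ^ (-N) * y ^ (d - 1) : ⋯)`. -/
def formExponents (m : ℕ) : Finset (Σ _ : Fin d, ℤ) :=
  Finset.univ.sigma fun w : Fin d =>
    Finset.Icc (if (w : ℕ) + 1 = d then -(N : ℤ) else 0) ((m : ℤ) - w)

/-- Row `w` contributes m - w + 1 exponents, and the top row w = d - 1 a further `N`. -/
theorem card_formExponents {m : ℕ} (hd : 1 ≤ d) (hm : d ≤ m) :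
    ((formExponents N d m).card : ℤ) = d * m + d - d.choose 2 + N := by
  obtain ⟨k, rfl⟩ := Nat.exists_eq_add_of_le' hd
  have h1 : ∀ w : Fin k, (Finset.Icc (if (w.castSucc : ℕ) + 1 = k + 1 then -(N : ℤ) else 0)
      ((m : ℤ) - (w.castSucc : Fin (k + 1)))).card = m + 1 - (w : ℕ) := fun w => by
    rw [if_neg (by simp [w.2.ne]), Int.card_Icc]
    simp
    omega
  have h2 : ∀ k ≤ m, ((∑ w : Fin k, (m + 1 - (w : ℕ)) : ℕ) : ℤ) = k * m + k - k.choose 2 := by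
    intro k
    induction k with
    | zero => simp
    | succ k ih =>
      intro hk
      rw [Fin.sum_univ_castSucc, Nat.cast_add]
      simp only [Fin.val_castSucc, Fin.val_last]
      rw [ih (by omega), Nat.choose_succ_succ' k 1, Nat.choose_one_right]
      push_cast [show k ≤ m + 1 by omega]
      ring
  rw [formExponents, Finset.card_sigma, Fin.sum_univ_castSucc, Nat.cast_add,
    Finset.sum_congr rfl fun w _ => h1 w, h2 k (by omega), Nat.choose_succ_succ' k 1,
    Nat.choose_one_right]
  simp only [Fin.val_last, if_true, Int.card_Icc]
  rw [Int.toNat_of_nonneg (by omega)]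
  push_cast
  ring

variable {r N d}

/-- A surviving monomial contains at most one of the last `r` coordinates, since 2(d - 1) ≥ d. With
one such factor the exponent of `t` is at most (m - 1) + (r - 1 - N), and `hN` says exactly that
this is at most m - (d - 1). -/
theorem exponents_bound {s : Fin (r + 2 + 1) → ℕ} {m : ℕ} (hs : ∑ k, s k = m) (hd : 2 ≤ d)
    (hN : r + d ≤ N + 3) (hw : ∑ k, s k * yExponent r d k < d) :
    (⟨⟨_, hw⟩, ∑ k, (s k : ℤ) * tExponent r N k⟩ : Σ _ : Fin d, ℤ) ∈ formExponents N d m := by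
  have hsum := hs
  have hy : ∑ k, s k * yExponent r d k =
      s 2 + (∑ i : Fin r, s i.succ.succ.succ) * (d - 1) := by
    rw [sum_univ_three]
    simp [Finset.sum_mul]
  have ht : ∑ k, (s k : ℤ) * tExponent r N k =
      s 1 + ∑ i : Fin r, (s i.succ.succ.succ : ℤ) * ((i : ℤ) - N) := by
    rw [sum_univ_three]
    simp
  have hlow : -(N : ℤ) * (∑ i : Fin r, s i.succ.succ.succ : ℕ) ≤
      ∑ i : Fin r, (s i.succ.succ.succ : ℤ) * ((i : ℤ) - N) := by
    push_cast
    rw [Finset.mul_sum]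
    refine Finset.sum_le_sum fun i _ => ?_
    nlinarith [Int.natCast_nonneg (s i.succ.succ.succ), Int.natCast_nonneg (i : ℕ)]
  have hupp : ∑ i : Fin r, (s i.succ.succ.succ : ℤ) * ((i : ℤ) - N) ≤
      ((r : ℤ) - 1 - N) * (∑ i : Fin r, s i.succ.succ.succ : ℕ) := by
    push_cast
    rw [Finset.mul_sum]
    refine Finset.sum_le_sum fun i _ => ?_
    have : (i : ℤ) ≤ r - 1 := by have := i.2; omega
    nlinarith [Int.natCast_nonneg (s i.succ.succ.succ)]
  rw [sum_univ_three] at hsum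
  simp only [formExponents, Finset.mem_sigma, Finset.mem_univ, true_and, Finset.mem_Icc]
  rw [ht]
  generalize ∑ k, s k * yExponent r d k = W at *
  generalize (∑ i : Fin r, (s i.succ.succ.succ : ℤ) * ((i : ℤ) - N)) = S at *
  generalize ∑ i : Fin r, s i.succ.succ.succ = Q at *
  -- `Q` counts the factors among the last `r` coordinates.
  obtain rfl | rfl | hQ : Q = 0 ∨ Q = 1 ∨ 2 ≤ Q := by omega
  · simp only [Nat.cast_zero, mul_zero, zero_mul, add_zero] at *
    split_ifs <;> omega
  · simp only [Nat.cast_one, mul_one, one_mul] at *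
    split_ifs <;> omega
  · have : 2 * (d - 1) ≤ Q * (d - 1) := Nat.mul_le_mul_right _ hQ
    omega

variable (r N d) {K : Type u} [Field K] {L : Type u} [Field L] [Algebra K L] (t : L)

/-- The coordinates `(1 : t : y : t ^ (-N) * y ^ (d - 1) : t ^ (1 - N) * y ^ (d - 1) : ⋯)` of a jet
along a line, of which the multiple line of degree `d` is the closure. -/
def lineJet (k : Fin (r + 2 + 1)) : Jet L d :=
  jetMonomial d t (tExponent r N k) (yExponent r d k)

variable {r N d t}

theorem lineJet_zero : lineJet r N d t 0 = 1 := jetMonomial_zero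

theorem lineJet_one : lineJet r N d t 1 = jetMonomial d t 1 0 := rfl

theorem prod_lineJet (ht : t ≠ 0) (s : Fin (r + 2 + 1) → ℕ) :
    ∏ k, lineJet r N d t k ^ s k =
      jetMonomial d t (∑ k, (s k : ℤ) * tExponent r N k) (∑ k, s k * yExponent r d k) := by
  rw [← prod_jetMonomial ht]
  exact Finset.prod_congr rfl fun k _ => jetMonomial_pow ht _ _ _

theorem range_aeval_lineJet (ht : t ≠ 0) (hd : 2 ≤ d) (hr : 1 ≤ r) (hN : r + d ≤ N + 3) {m : ℕ}
    (hm : N + d ≤ m) :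
    LinearMap.range ((MvPolynomial.aeval (R := K) (lineJet r N d t)).toLinearMap.comp
      (MvPolynomial.homogeneousSubmodule (Fin (r + 2 + 1)) K m).subtype) =
      Submodule.span K (Set.range fun x : formExponents N d m =>
        jetMonomial d t x.1.2 x.1.1) := by
  apply le_antisymm
  · rintro _ ⟨F, rfl⟩
    change MvPolynomial.aeval (lineJet r N d t) (F : MvPolynomial (Fin (r + 2 + 1)) K) ∈ _
    rw [MvPolynomial.aeval_def, MvPolynomial.eval₂_eq']
    refine sum_mem fun s hs => ?_
    rw [← Algebra.smul_def, prod_lineJet ht]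
    refine Submodule.smul_mem _ _ ?_
    have hsm : ∑ k, s k = m := by
      rw [MvPolynomial.IsHomogeneous.degree_eq_sum_deg_support F.2 hs]
      exact (Finset.sum_subset (Finset.subset_univ _) (by simp)).symm
    by_cases hw : ∑ k, s k * yExponent r d k < d
    · exact Submodule.subset_span ⟨⟨_, exponents_bound hsm hd hN hw⟩, rfl⟩
    · rw [jetMonomial_eq_zero _ (not_lt.mp hw)]
      exact zero_mem _
  · rw [Submodule.span_le]
    rintro _ ⟨⟨⟨w, e⟩, hx⟩, rfl⟩
    simp only [formExponents, Finset.mem_sigma, Finset.mem_univ, true_and, Finset.mem_Icc] at hx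
    obtain ⟨h1, h2⟩ := hx
    have hX : ∀ i a, (MvPolynomial.X i ^ a : MvPolynomial (Fin (r + 2 + 1)) K).IsHomogeneous a :=
      fun i a => MvPolynomial.isHomogeneous_X_pow i a
    by_cases he : 0 ≤ e
    · obtain ⟨e, rfl⟩ := Int.eq_ofNat_of_zero_le he
      obtain ⟨a, ha⟩ : ∃ a, a + e + w = m := ⟨m - e - w, by omega⟩
      refine ⟨⟨MvPolynomial.X 0 ^ a * MvPolynomial.X 1 ^ e * MvPolynomial.X 2 ^ (w : ℕ),
        ha ▸ ((hX _ _).mul (hX _ _)).mul (hX _ _)⟩, ?_⟩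
      have h2 : lineJet r N d t 2 = jetMonomial d t 0 1 := rfl
      simp [lineJet_zero, lineJet_one, h2, jetMonomial_pow ht, jetMonomial_mul ht]
    -- Negative exponents occur only in the top row. They come from the coordinate t^(-N) y^(d-1)
    -- multiplied by a power of `t`, and m ≥ N leaves room for the required degree.
    · have hwd : (w : ℕ) + 1 = d := by
        by_contra h
        rw [if_neg h] at h1
        exact he h1
      rw [if_pos hwd] at h1
      obtain ⟨c, hc⟩ := Int.eq_ofNat_of_zero_le (show 0 ≤ e + N by omega)
      obtain ⟨a, ha⟩ : ∃ a, a + c + 1 = m := ⟨m - c - 1, by omega⟩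
      let k : Fin (r + 2 + 1) := Fin.succ (Fin.succ (Fin.succ ⟨0, hr⟩))
      refine ⟨⟨MvPolynomial.X 0 ^ a * MvPolynomial.X 1 ^ c * MvPolynomial.X k ^ 1,
        ha ▸ ((hX _ _).mul (hX _ _)).mul (hX _ _)⟩, ?_⟩
      have h3 : lineJet r N d t k = jetMonomial d t (-N) w := by
        have : (w : ℕ) = d - 1 := by omega
        rw [lineJet, tExponent_succ, yExponent_succ, this]
        simp
      have h4 : (c : ℤ) + -N = e := by omega
      simp [lineJet_zero, lineJet_one, h3, jetMonomial_pow ht, jetMonomial_mul ht, h4]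

theorem finrank_range_aeval_lineJet (hT : LinearIndependent K fun e : ℤ => t ^ e)
    (ht : t ≠ 0) (hd : 2 ≤ d) (hr : 1 ≤ r) (hN : r + d ≤ N + 3) {m : ℕ} (hm : N + d ≤ m) :
    (Module.finrank K (LinearMap.range ((MvPolynomial.aeval (R := K) (lineJet r N d t)).toLinearMap.comp
      (MvPolynomial.homogeneousSubmodule (Fin (r + 2 + 1)) K m).subtype)) : ℤ) =
      d * m + d - d.choose 2 + N := by
  rw [range_aeval_lineJet ht hd hr hN hm, finrank_span_eq_card, Fintype.card_coe,
    card_formExponents N d (by omega) (by omega)]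
  exact (linearIndependent_jetMonomial hT).comp
    (fun x : formExponents N d m => ((x.1.1, x.1.2) : Fin d × ℤ)) fun x y h =>
      Subtype.ext (Sigma.ext (congrArg Prod.fst h) (heq_of_eq (congrArg Prod.snd h)))

/-- The coordinates are distinct monomials. The only possible coincidence is y = t^(i-N) y^(d-1)
with d = 2 and i = N, which r ≤ N excludes. -/
theorem linearIndependent_lineJet (hT : LinearIndependent K fun e : ℤ => t ^ e)
    (hd : 2 ≤ d) (hN : d = 2 → r ≤ N) : LinearIndependent K (lineJet r N d t) := by
  have hlt : ∀ k, yExponent r d k < d := by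
    refine fin_cases_three ?_ ?_ ?_ fun i => ?_ <;> simp <;> omega
  refine (linearIndependent_jetMonomial hT).comp
    (fun k => ((⟨yExponent r d k, hlt k⟩, tExponent r N k) : Fin d × ℤ)) ?_
  intro k l h
  have h1 : yExponent r d k = yExponent r d l := congrArg Fin.val (congrArg Prod.fst h)
  have h2 : tExponent r N k = tExponent r N l := congrArg Prod.snd h
  clear h
  revert h1 h2
  revert k l
  refine fin_cases_three ?_ ?_ ?_ fun i => ?_ <;>
  refine fin_cases_three ?_ ?_ ?_ fun j => ?_ <;>
  simp <;> omega

theorem isNonDegenerate_imageι {n : ℕ} {B : Type u} [CommRing B] [Algebra K B]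
    (b : Fin (n + 1) → B) (h0 : IsUnit (b 0)) (hb : ∀ i, IsUnit (b i) ∨ IsNilpotent (b i))
    (hLI : LinearIndependent K b) : IsNonDegenerate (pointMap (K := K) b h0).imageι := by
  intro l hl hmem
  rw [mem_vanishingForms_imageι b h0 hb] at hmem
  obtain ⟨c, hc⟩ := (Submodule.mem_span_range_iff_exists_fun K).mp
    (MvPolynomial.homogeneousSubmodule_one_eq_span_X.le l.2)
  rw [← hc, map_sum] at hmem
  simp only [map_smul, MvPolynomial.aeval_X] at hmem
  have := Fintype.linearIndependent_iff.mp hLI c hmem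
  exact hl (Subtype.ext (by rw [← hc]; simp [this]))

theorem isUnit_or_isNilpotent_lineJet (ht : t ≠ 0) (k : Fin (r + 2 + 1)) :
    IsUnit (lineJet r N d t k) ∨ IsNilpotent (lineJet r N d t k) := by
  obtain h | h := Nat.eq_zero_or_pos (yExponent r d k)
  · left
    rw [lineJet, h]
    exact isUnit_jetMonomial ht _
  · exact Or.inr (isNilpotent_jetMonomial ht _ h)

theorem isCurve_lineJet (hT : LinearIndependent K fun e : ℤ => t ^ e) (ht : t ≠ 0) (hd : 2 ≤ d)
    (h0 : IsUnit (lineJet r N d t 0)) :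
    IsCurve (pointMap (K := K) (lineJet r N d t) h0).imageι := by
  have hd0 : d ≠ 0 := by omega
  let ρ := jetResidue K L hd0
  have h1 : ρ (lineJet r N d t 0) = 1 := by simp [ρ, lineJet, jetResidue_jetMonomial]
  have h2 : ρ (lineJet r N d t 1) = t := by simp [ρ, lineJet, jetResidue_jetMonomial]
  have h3 : ρ (lineJet r N d t 2) = 0 := by simp [ρ, lineJet, jetResidue_jetMonomial]
  have h4 : ∀ i : Fin r, ρ (lineJet r N d t i.succ.succ.succ) = 0 := fun i => by
    have : d - 1 ≠ 0 := by omega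
    simp [ρ, lineJet, jetResidue_jetMonomial, this]
  refine isCurve_imageι (lineJet r N d t) h0 (ρ : Jet L d →+* L)
    (ker_jetResidue_le hd0) (isUnit_of_jetResidue_ne_zero hd0)
    (fin_cases_three (Or.inr ⟨isUnit_jetMonomial ht _, ?_⟩) (Or.inr ⟨isUnit_jetMonomial ht _, ?_⟩)
      (Or.inl (isNilpotent_jetMonomial ht _ one_pos))
      fun i => Or.inl (isNilpotent_jetMonomial ht _ (by simp; omega)))
  -- On the two charts meeting the line the affine parameter is `t`, respectively its inverse.
  · refine ⟨(Polynomial.aeval (R := K) (t ^ (1 : ℤ)) : Polynomial K →+* L),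
      injective_aeval_zpow hT one_ne_zero,
      range_comp_evalAway _ ρ (isUnit_jetMonomial ht _) _
        (fin_cases_three ⟨1, ?_⟩ ⟨Polynomial.X, ?_⟩ ⟨0, ?_⟩ fun i => ⟨0, ?_⟩) 1 ?_⟩ <;>
    simp [h1, h2, h3, h4]
  · refine ⟨(Polynomial.aeval (R := K) (t ^ (-1 : ℤ)) : Polynomial K →+* L),
      injective_aeval_zpow hT (by norm_num),
      range_comp_evalAway _ ρ (isUnit_jetMonomial ht _) _
        (fin_cases_three ⟨Polynomial.X, ?_⟩ ⟨1, ?_⟩ ⟨0, ?_⟩ fun i => ⟨0, ?_⟩) 0 ?_⟩ <;>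
    simp [h1, h2, h3, h4, ht]

theorem isHilbertPolynomial_lineJet (hT : LinearIndependent K fun e : ℤ => t ^ e) (ht : t ≠ 0)
    (hd : 2 ≤ d) (hr : 1 ≤ r) (hN : r + d ≤ N + 3) (h0 : IsUnit (lineJet r N d t 0)) :
    IsHilbertPolynomial (pointMap (K := K) (lineJet r N d t) h0).imageι
      (Polynomial.C (d : ℚ) * Polynomial.X + Polynomial.C (d - d.choose 2 + N : ℚ)) := by
  filter_upwards [Filter.eventually_ge_atTop (N + d)] with m hm
  rw [hilbertFunction_eq_finrank_range _ h0 (isUnit_or_isNilpotent_lineJet ht)]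
  have h := finrank_range_aeval_lineJet (K := K) hT ht hd hr hN hm
  have h2 := congrArg (Int.cast : ℤ → ℚ) h
  rw [Int.cast_natCast] at h2
  rw [h2]
  simp
  ring

end MultipleLine

/-- Laurent series serve as L: distinct powers of the variable have disjoint supports. -/
theorem exists_linearIndependent_zpow (K : Type u) [Field K] :
    ∃ (L : Type u) (_ : Field L) (_ : Algebra K L) (t : L),
      LinearIndependent K fun e : ℤ => t ^ e := by
  classical
  refine ⟨LaurentSeries K, inferInstance, HahnSeries.instAlgebra, HahnSeries.single (1 : ℤ) 1, ?_⟩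
  rw [linearIndependent_iff']
  intro s c h x hx
  have h2 := congrArg (fun q : LaurentSeries K => q.coeff x) h
  simp only [← RatFunc.single_zpow, HahnSeries.coeff_sum, HahnSeries.coeff_zero] at h2
  rw [Finset.sum_eq_single x] at h2
  · exact (mul_one (c x)).symm.trans
      ((congrArg (c x * ·) (HahnSeries.coeff_single_same x (1 : K)).symm).trans h2)
  · intro y _ hy
    exact (congrArg (c y * ·) (HahnSeries.coeff_single_of_ne hy.symm)).trans (mul_zero _)
  · exact fun h => absurd hx h

end LocallyCMCurve

end

theorem theorem3p2 {K : Type u} [Field K] [IsAlgClosed K] [CharZero K] (n d : ℕ)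
    (hn : 3 ≤ n) (hd : 2 ≤ d) (g : ℤ)
    (hg : g ≤ if 3 ≤ d then ((d - 2).choose 2 : ℤ) - ((n : ℤ) - 3) else 2 - (n : ℤ)) :
    ∃ (C : AlgebraicGeometry.Scheme.{u}) (ι : C ⟶ LocallyCMCurve.ProjectiveNSpace K n),
      LocallyCMCurve.IsCurve ι ∧ LocallyCMCurve.IsNonDegenerate ι ∧
        LocallyCMCurve.HasDegree ι d ∧ LocallyCMCurve.HasArithmeticGenus ι g := by
  obtain ⟨r, rfl⟩ := Nat.exists_eq_add_of_le' (show 2 ≤ n by omega)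
  obtain ⟨k, rfl⟩ := Nat.exists_eq_add_of_le' hd
  have hk : ((k + 1).choose 2 : ℤ) = k + k.choose 2 := by
    rw [Nat.choose_succ_succ' k 1, Nat.choose_one_right]; push_cast; ring
  have hk2 : ((k + 2).choose 2 : ℤ) = k + 1 + (k + 1).choose 2 := by
    rw [Nat.choose_succ_succ' (k + 1) 1, Nat.choose_one_right]; push_cast; ring
  rw [Nat.add_sub_cancel] at hg
  -- With d = k + 2 the genus of the multiple line is C(k+1,2) - N, which dictates `N`.
  obtain ⟨N, hN⟩ : ∃ N : ℕ, (N : ℤ) = (k + 1).choose 2 - g := by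
    refine ⟨((k + 1).choose 2 - g : ℤ).toNat, Int.toNat_of_nonneg ?_⟩
    split_ifs at hg
    · omega
    · have := Int.natCast_nonneg ((k + 1).choose 2)
      omega
  -- For d ≥ 3 this is the genus bound itself, as C(d-1,2) - C(d-2,2) = d - 2; for d = 2 it is
  -- weaker than N ≥ r.
  have hN3 : r + (k + 2) ≤ N + 3 := by
    split_ifs at hg
    · omega
    · obtain rfl : k = 0 := by omega
      simp at hN
      omega
  have hN2 : k + 2 = 2 → r ≤ N := by
    intro h
    obtain rfl : k = 0 := by omega
    simp at hN hg
    omega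
  obtain ⟨L, _, _, t, hT⟩ := LocallyCMCurve.exists_linearIndependent_zpow K
  have ht : t ≠ 0 := by simpa using hT.ne_zero 1
  have h0 : IsUnit (LocallyCMCurve.lineJet r N (k + 2) t 0) :=
    LocallyCMCurve.isUnit_jetMonomial ht _
  have hP := LocallyCMCurve.isHilbertPolynomial_lineJet hT ht hd (by omega) hN3 h0
  have hd0 : ((k + 2 : ℕ) : ℚ) ≠ 0 := Nat.cast_ne_zero.mpr (by omega)
  refine ⟨_, (LocallyCMCurve.pointMap (K := K) _ h0).imageι,
    LocallyCMCurve.isCurve_lineJet hT ht hd h0,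
    LocallyCMCurve.isNonDegenerate_imageι _ h0
      (LocallyCMCurve.isUnit_or_isNilpotent_lineJet ht)
      (LocallyCMCurve.linearIndependent_lineJet hT hd hN2),
    ⟨_, hP, Polynomial.natDegree_linear hd0, Polynomial.leadingCoeff_linear hd0⟩, ⟨_, hP, ?_⟩⟩
  have hg' : (g : ℚ) = (k + 1).choose 2 - N := by
    have : g = (k + 1).choose 2 - N := by omega
    exact_mod_cast congrArg (Int.cast : ℤ → ℚ) this
  have hk2' : ((k + 2).choose 2 : ℚ) = k + 1 + (k + 1).choose 2 := by exact_mod_cast hk2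
  rw [hg', hk2']
  simp
  ring
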